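/- Let $\mathcal{F}$ be a small (elementary) topos and let $\mathcal{E}$ be a logical subtopos of $\mathcal{F}$, i.e. a full subcategory closed under some choice of finite limits, exponentials and subobject classifier in $\mathcal{F}$. Write $i : \mathcal{E} \hookrightarrow \mathcal{F}$ for the inclusion, and $\mathcal{F}/(-)$ for the self-indexing of $\mathcal{F}$, the $\mathcal{F}$-indexed category (pseudofunctor $\mathcal{F}^{\mathrm{op}} \to \mathbf{CAT}$) that sends $I$ to the slice $\mathcal{F}/I$ and a morphism to the associated pullback functor. For a presheaf, resp. an indexed category, $P$ on $\mathcal{F}$, put $(i_*i^*P)(I) = \mathrm{Hom}(i^*(\mathrm{y}I), i^*P)$, where $i^*$ is restriction to $\mathcal{E}$, $\mathrm{y}I = \mathrm{Hom}_{\mathcal{F}}(-,I)$, and $\mathrm{Hom}$ is the set of natural transformations, resp. the category of pseudonatural transformations and modifications. The subtopos $\mathcal{E}$ is called dense if 1. every object $X$ of $\mathcal{F}$ is a sheaf on $(\mathcal{F},\mathcal{E})$, i.e. the unit $\mathrm{y}X \to i_*i^*(\mathrm{y}X)$ is an isomorphism, and 2. $\mathcal{F}/(-)$ is a stack on $(\mathcal{F},\mathcal{E})$,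 i.e. the unit $\mathcal{F}/(-) \to i_*i^*(\mathcal{F}/(-))$ is an equivalence. A morphism $p : X \to B$ of $\mathcal{F}$ is called locally $\mathcal{E}$-small if for every $A \in \mathcal{E}$ and $f : A \to B$ there is a pullback of $p$ along $f$ whose vertex is in $\mathcal{E}$. These maps are stable under pullback; let $(\mathcal{F}/(-))_{<\mathcal{E}}$ be the indexed full subcategory of $\mathcal{F}/(-)$ whose value at $I$ is the full subcategory $(\mathcal{F}/I)_{<\mathcal{E}}$ of $\mathcal{F}/I$ on the locally $\mathcal{E}$-small maps with codomain $I$. **Proposition.** If $\mathcal{E}$ is a dense logical subtopos of the small topos $\mathcal{F}$, then $(\mathcal{F}/(-))_{<\mathcal{E}}$ is an indexed logical subtopos of $\mathcal{F}/(-)$. That is, both are indexed toposes (all their fibres are toposes and all their reindexing functors are logical, i.e. preserve finite limits, exponentials and the subobject classifier), and for every $I \in \mathcal{F}$ the full subcategory $(\mathcal{F}/I)_{<\mathcal{E}}$ is a logical subtopos of $\mathcal{F}/I$. -/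

import Mathlib

open CategoryTheory Limits Opposite Bicategory
universe v u v' u'

namespace DenseTopos

section Topos

variable {C : Type u} [Category.{v} C] {D : Type u'} [Category.{v'} D]

/-- A cone `P ← Q → A` together with `ev : Q ⟶ B` exhibits `P` as an exponential `B ^ A`:
`Q` is a product `P × A`, and every `g : X × A ⟶ B` factors as `(h × A) ≫ ev` for a unique
`h : X ⟶ P`. Products are described by limit cones, so no choice of products is involved. -/
def IsExponential {A B P Q : C} (fst : Q ⟶ P) (snd : Q ⟶ A) (ev : Q ⟶ B) : Prop :=
  Nonempty (IsLimit (BinaryFan.mk fst snd)) ∧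
    ∀ ⦃X Y : C⦄ (p : Y ⟶ X) (q : Y ⟶ A), Nonempty (IsLimit (BinaryFan.mk p q)) →
      ∀ g : Y ⟶ B, ∃! h : X ⟶ P, ∃ k : Y ⟶ Q, k ≫ fst = p ≫ h ∧ k ≫ snd = q ∧ k ≫ ev = g

/-- The morphism `t : Ω₀ ⟶ Ω` is a subobject classifier (with `Ω₀` terminal). -/
def IsSubobjectClassifier {Ω₀ Ω : C} (t : Ω₀ ⟶ Ω) : Prop :=
  Nonempty (IsTerminal Ω₀) ∧
    ∀ ⦃U X : C⦄ (m : U ⟶ X) [Mono m], ∃! χ : X ⟶ Ω, ∃ χ₀ : U ⟶ Ω₀, IsPullback m χ₀ χ t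

/-- `IsSubobjectClassifier` is the property of the truth morphism in Mathlib's structure. -/
lemma isSubobjectClassifier_truth (c : Subobject.Classifier C) :
    IsSubobjectClassifier c.truth :=
  ⟨⟨c.isTerminalΩ₀⟩, fun _ _ m _ ↦
    ⟨c.χ m, ⟨c.χ₀ _, c.isPullback m⟩, fun _ ⟨_, h⟩ ↦ c.uniq m h⟩⟩

lemma exists_classifier_of_isSubobjectClassifier {Ω₀ Ω : C} {t : Ω₀ ⟶ Ω}
    (ht : IsSubobjectClassifier t) : ∃ c : Subobject.Classifier C, c.Ω = Ω := by
  obtain ⟨⟨h₀⟩, h⟩ := ht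
  refine ⟨Subobject.Classifier.mkOfTerminalΩ₀ Ω₀ h₀ Ω t (fun m _ ↦ (h m).choose) ?_ ?_, rfl⟩
  · intro U X m _
    obtain ⟨χ₀, hχ⟩ := (h m).choose_spec.1
    rwa [h₀.hom_ext (h₀.from U) χ₀]
  · intro U X m _ χ' hχ'
    exact (h m).choose_spec.2 χ' ⟨_, hχ'⟩

variable (C) in
/-- An (elementary) topos: finite limits, exponentials and a subobject classifier. -/
class IsTopos : Prop extends HasFiniteLimits C, HasSubobjectClassifier C where
  exists_exponential (A B : C) :
    ∃ (P Q : C) (fst : Q ⟶ P) (snd : Q ⟶ A) (ev : Q ⟶ B), IsExponential fst snd ev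

/-- A logical functor preserves finite limits, exponentials and the subobject classifier. -/
structure IsLogicalFunctor (G : C ⥤ D) : Prop where
  preservesFiniteLimits : PreservesFiniteLimits G
  map_exponential {A B P Q : C} (fst : Q ⟶ P) (snd : Q ⟶ A) (ev : Q ⟶ B) :
    IsExponential fst snd ev → IsExponential (G.map fst) (G.map snd) (G.map ev)
  map_classifier (c : Subobject.Classifier C) : IsSubobjectClassifier (G.map c.truth)

/-- The full subcategory of the topos `C` on the objects satisfying `E` is a logical subtopos:
it is closed under some choice of topos structure in `C`. That is, each finite diagram in `E` has a
limit in `C` whose vertex is in `E`, any two objects of `E` have an exponential in `C` which is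
in `E`, and `C` has a subobject classifier which is in `E`. (`E` need not be replete.) -/
structure IsLogicalSubtopos (E : ObjectProperty C) : Prop where
  exists_limit (J : Type) [SmallCategory J] [FinCategory J] (K : J ⥤ C) :
    (∀ j, E (K.obj j)) → ∃ c : Cone K, Nonempty (IsLimit c) ∧ E c.pt
  exists_exponential {A B : C} : E A → E B →
    ∃ (P Q : C) (fst : Q ⟶ P) (snd : Q ⟶ A) (ev : Q ⟶ B), IsExponential fst snd ev ∧ E P
  exists_classifier : ∃ c : Subobject.Classifier C, E c.Ω

end Topos

section SelfIndexing
variable {F : Type u} [Category.{v} F] [HasPullbacks F]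

lemma pullback_hom_ext {X Y : F} {f : X ⟶ Y} {p : Over Y} {q : Over X}
    {a b : q ⟶ (Over.pullback f).obj p}
    (h : a.left ≫ pullback.fst p.hom f = b.left ≫ pullback.fst p.hom f) : a = b := by
  ext
  apply pullback.hom_ext h
  exact (Over.w a).trans (Over.w b).symm

lemma pullback_pullback_hom_ext {X Y Z : F} {f : X ⟶ Y} {g : Y ⟶ Z} {p : Over Z} {q : Over X}
    {a b : q ⟶ (Over.pullback f).obj ((Over.pullback g).obj p)}
    (h : a.left ≫ pullback.fst (pullback.snd p.hom g) f ≫ pullback.fst p.hom g =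
      b.left ≫ pullback.fst (pullback.snd p.hom g) f ≫ pullback.fst p.hom g) : a = b := by
  refine pullback_hom_ext (pullback.hom_ext ?_ ?_)
  · exact (Category.assoc _ _ _).trans (h.trans (Category.assoc _ _ _).symm)
  · have key (c : q ⟶ (Over.pullback f).obj ((Over.pullback g).obj p)) :
        (c.left ≫ pullback.fst (pullback.snd p.hom g) f) ≫ pullback.snd p.hom g = q.hom ≫ f := by
      have hc : c.left ≫ pullback.snd (pullback.snd p.hom g) f = q.hom := Over.w c
      rw [Category.assoc, pullback.condition, ← Category.assoc, hc]
    exact (key a).trans (key b).symm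

lemma pullback_map_left_fst {X Y : F} (f : X ⟶ Y) {p q : Over Y} (a : p ⟶ q) :
    ((Over.pullback f).map a).left ≫ pullback.fst q.hom f = pullback.fst p.hom f ≫ a.left :=
  pullback.lift_fst _ _ _

/-- The canonical isomorphism `(f ≫ g)^* ≅ f^* g^*`. -/
noncomputable def pullbackCompIso {X Y Z : F} (f : X ⟶ Y) (g : Y ⟶ Z) :
    Over.pullback (f ≫ g) ≅ Over.pullback g ⋙ Over.pullback f :=
  NatIso.ofComponents
    (fun p ↦ Over.isoMk (pullbackLeftPullbackSndIso p.hom g f).symm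
      (pullbackLeftPullbackSndIso_inv_snd_snd p.hom g f))
    (fun {p q} a ↦ by
      apply pullback_pullback_hom_ext
      have h₁ := pullback_map_left_fst (f ≫ g) a
      have h₂ := pullback_map_left_fst g a
      have h₃ := pullback_map_left_fst f ((Over.pullback g).map a)
      have h₄ := pullbackLeftPullbackSndIso_inv_fst p.hom g f
      have h₅ := pullbackLeftPullbackSndIso_inv_fst q.hom g f
      calc _ = ((Over.pullback (f ≫ g)).map a).left ≫ (pullbackLeftPullbackSndIso q.hom g f).inv ≫
              pullback.fst (pullback.snd q.hom g) f ≫ pullback.fst q.hom g := Category.assoc _ _ _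
        _ = (pullbackLeftPullbackSndIso p.hom g f).inv ≫
              pullback.fst (pullback.snd p.hom g) f ≫ pullback.fst p.hom g ≫ a.left := by
            rw [h₅, h₁, ← h₄]; simp only [Category.assoc]
        _ = (pullbackLeftPullbackSndIso p.hom g f).inv ≫
              ((Over.pullback f).map ((Over.pullback g).map a)).left ≫
              pullback.fst (pullback.snd q.hom g) f ≫ pullback.fst q.hom g := by
            erw [← h₂, reassoc_of% h₃]; rfl
        _ = _ := (Category.assoc _ _ _).symm)

/-- The canonical isomorphism `(𝟙 X)^* ≅ id`. -/
noncomputable def pullbackIdIso (X : F) : Over.pullback (𝟙 X) ≅ 𝟭 (Over X) :=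
  NatIso.ofComponents
    (fun p ↦ Over.isoMk (asIso (pullback.fst p.hom (𝟙 X)))
      (by simpa using pullback.condition (f := p.hom) (g := 𝟙 X)))
    (fun {p q} a ↦ by
      ext
      exact pullback_map_left_fst _ a)

lemma pullbackCompIso_hom_fst {X Y Z : F} (f : X ⟶ Y) (g : Y ⟶ Z) (p : Over Z) :
    ((pullbackCompIso f g).hom.app p).left ≫ pullback.fst (pullback.snd p.hom g) f ≫
      pullback.fst p.hom g = pullback.fst p.hom (f ≫ g) :=
  pullbackLeftPullbackSndIso_inv_fst _ _ _

lemma pullbackCompIso_inv_fst {X Y Z : F} (f : X ⟶ Y) (g : Y ⟶ Z) (p : Over Z) :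
    ((pullbackCompIso f g).inv.app p).left ≫ pullback.fst p.hom (f ≫ g) =
      pullback.fst (pullback.snd p.hom g) f ≫ pullback.fst p.hom g :=
  pullbackLeftPullbackSndIso_hom_fst _ _ _

lemma pullbackIdIso_hom_left {X : F} (p : Over X) :
    ((pullbackIdIso X).hom.app p).left = pullback.fst p.hom (𝟙 X) := rfl

lemma eqToHom_fst {X Y : F} {f g : X ⟶ Y} (e : f = g)
    (h : (Over.pullback f).toCatHom = (Over.pullback g).toCatHom) (p : Over Y) :
    ((eqToHom h).toNatTrans.app p).left ≫ pullback.fst p.hom g = pullback.fst p.hom f := by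
  subst e
  exact Category.id_comp _

lemma pullback_assoc_coherence {W X Y Z : F} (h : W ⟶ X) (g : X ⟶ Y) (f : Y ⟶ Z) (p : Over Z) :
    (((pullbackCompIso h (g ≫ f)).hom.app p).left ≫
      ((Over.pullback h).map ((pullbackCompIso g f).hom.app p)).left ≫
      ((pullbackCompIso h g).inv.app ((Over.pullback f).obj p)).left ≫
      ((pullbackCompIso (h ≫ g) f).inv.app p).left) ≫ pullback.fst p.hom ((h ≫ g) ≫ f) =
    pullback.fst p.hom (h ≫ g ≫ f) := by
  have h₁ := pullbackCompIso_inv_fst (h ≫ g) f p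
  have h₂ := pullbackCompIso_inv_fst h g ((Over.pullback f).obj p)
  have h₃ := pullback_map_left_fst h ((pullbackCompIso g f).hom.app p)
  have h₄ := pullbackCompIso_hom_fst g f p
  have h₅ := pullbackCompIso_hom_fst h (g ≫ f) p
  rw [← h₅, ← h₄]
  simp only [Category.assoc]
  rw [h₁]
  congr 1
  erw [reassoc_of% h₂, reassoc_of% h₃]
  rfl

lemma pullback_left_coherence {X Y : F} (f : X ⟶ Y) (p : Over Y) :
    (((pullbackCompIso f (𝟙 Y)).hom.app p).left ≫
      ((Over.pullback f).map ((pullbackIdIso Y).hom.app p)).left) ≫ pullback.fst p.hom f =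
    pullback.fst p.hom (f ≫ 𝟙 Y) := by
  have h₁ := pullback_map_left_fst f ((pullbackIdIso Y).hom.app p)
  rw [← pullbackCompIso_hom_fst f (𝟙 Y) p, Category.assoc]
  congr 1

lemma pullback_right_coherence {X Y : F} (f : X ⟶ Y) (p : Over Y) :
    (((pullbackCompIso (𝟙 X) f).hom.app p).left ≫
      ((pullbackIdIso X).hom.app ((Over.pullback f).obj p)).left) ≫ pullback.fst p.hom f =
    pullback.fst p.hom (𝟙 X ≫ f) := by
  rw [← pullbackCompIso_hom_fst (𝟙 X) f p, Category.assoc]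
  rfl

variable (F) in
/-- The self-indexing `F/(-)`: it sends `I` to the slice `F/I`, and `f : I ⟶ J` to the pullback
functor `f^* : F/J ⥤ F/I`. A `C`-indexed category is a pseudofunctor
`LocallyDiscrete Cᵒᵖ ⥤ᵖ Cat`. -/
noncomputable def selfIndexing : LocallyDiscrete Fᵒᵖ ⥤ᵖ Cat.{v, max u v} :=
  LocallyDiscrete.mkPseudofunctor
    (fun I ↦ Cat.of (Over I.unop))
    (fun f ↦ (Over.pullback f.unop).toCatHom)
    (fun I ↦ Cat.Hom.isoMk (pullbackIdIso I.unop))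
    (fun f g ↦ Cat.Hom.isoMk (pullbackCompIso g.unop f.unop))
    (fun f g h ↦ by
      ext p
      apply pullback_hom_ext
      refine Eq.trans ?_ (eqToHom_fst (by simp) _ p).symm
      refine Eq.trans ?_ (pullback_assoc_coherence h.unop g.unop f.unop p)
      exact congrArg (fun t ↦ (_ ≫ _ ≫ t) ≫ _) (Category.id_comp (_ ≫ _)))
    (fun f ↦ by
      ext p
      apply pullback_hom_ext
      refine Eq.trans ?_ (eqToHom_fst (by simp) _ p).symm
      refine Eq.trans ?_ (pullback_left_coherence f.unop p)
      exact congrArg (fun t ↦ (_ ≫ t) ≫ _) (Category.comp_id _))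
    (fun f ↦ by
      ext p
      apply pullback_hom_ext
      refine Eq.trans ?_ (eqToHom_fst (by simp) _ p).symm
      refine Eq.trans ?_ (pullback_right_coherence f.unop p)
      exact congrArg (fun t ↦ (_ ≫ t) ≫ _) (Category.comp_id _))
end SelfIndexing

section Site
variable {D : Type u} [Category.{v} D] (E : ObjectProperty D)

/-- A matching family for the presheaf `P` at `I`, on the site `(D, E)` given by a full
subcategory `E` of `D` with inclusion `i`: an element of `(i_* i^* P)(I) = Hom (i^* (y I), i^* P)`,
where `i^*` is restriction of presheaves. -/
abbrev MatchingFamily (P : Dᵒᵖ ⥤ Type v) (I : D) : Type (max u v) :=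
  E.ι.op ⋙ yoneda.obj I ⟶ E.ι.op ⋙ P

/-- The unit `P ⟶ i_* i^* P` at `I`: it sends `e` to the family `f ↦ P(f)(e)`. -/
def canonicalMatchingFamily (P : Dᵒᵖ ⥤ Type v) (I : D) (e : P.obj (op I)) :
    MatchingFamily E P I :=
  Functor.whiskerLeft E.ι.op (yonedaEquiv.symm e)

/-- `P` is a sheaf on `(D, E)`: the unit `P ⟶ i_* i^* P` is an isomorphism. -/
def IsSheafOn (P : Dᵒᵖ ⥤ Type v) : Prop :=
  ∀ I : D, Function.Bijective (canonicalMatchingFamily E P I)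

variable (P : LocallyDiscrete Dᵒᵖ ⥤ᵖ Cat.{v', u'})

/-- A descent datum for the indexed category `P` at `I`, on the site `(D, E)`: an object of
`(i_* i^* P)(I)`, that is, a pseudonatural transformation `i^* (y I) ⟶ i^* P` of `E`-indexed
categories, where `y I` is regarded as a discrete indexed category. Explicitly, it assigns to
each `f : J ⟶ I` with `J` in `E` an object of `P(J)`, with coherent isomorphisms
`P(g)(obj f) ≅ obj (g ≫ f)` for the morphisms `g` of `E`. -/
structure DescentDatum (I : D) where
  obj {J : D} (hJ : E J) (f : J ⟶ I) : P.obj ⟨op J⟩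
  iso {J K : D} (hJ : E J) (hK : E K) (g : K ⟶ J) (f : J ⟶ I) (h : K ⟶ I) (w : g ≫ f = h) :
    (P.map g.op.toLoc).toFunctor.obj (obj hJ f) ≅ obj hK h
  iso_id {J : D} (hJ : E J) (f : J ⟶ I) :
    (iso hJ hJ (𝟙 J) f f (Category.id_comp f)).hom =
      (P.mapId ⟨op J⟩).hom.toNatTrans.app (obj hJ f)
  iso_comp {J K L : D} (hJ : E J) (hK : E K) (hL : E L) (g : K ⟶ J) (g' : L ⟶ K)
    (f : J ⟶ I) (h : K ⟶ I) (k : L ⟶ I) (w : g ≫ f = h) (w' : g' ≫ h = k) :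
    (iso hJ hL (g' ≫ g) f k (by rw [Category.assoc, w, w'])).hom =
      (P.mapComp g.op.toLoc g'.op.toLoc).hom.toNatTrans.app (obj hJ f) ≫
        (P.map g'.op.toLoc).toFunctor.map (iso hJ hK g f h w).hom ≫
          (iso hK hL g' h k w').hom

namespace DescentDatum
variable {E P} {I : D}

/-- A morphism of descent data: a modification. -/
@[ext]
structure Hom (α β : DescentDatum E P I) where
  hom {J : D} (hJ : E J) (f : J ⟶ I) : α.obj hJ f ⟶ β.obj hJ f
  comm {J K : D} (hJ : E J) (hK : E K) (g : K ⟶ J) (f : J ⟶ I) (h : K ⟶ I) (w : g ≫ f = h) :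
    (P.map g.op.toLoc).toFunctor.map (hom hJ f) ≫ (β.iso hJ hK g f h w).hom =
      (α.iso hJ hK g f h w).hom ≫ hom hK h

instance : Category (DescentDatum E P I) where
  Hom α β := Hom α β
  id α :=
    { hom hJ f := 𝟙 _
      comm hJ hK g f h w := by simp }
  comp φ ψ :=
    { hom hJ f := φ.hom hJ f ≫ ψ.hom hJ f
      comm hJ hK g f h w := by
        rw [Functor.map_comp, Category.assoc, ψ.comm, ← Category.assoc, φ.comm, Category.assoc] }
  id_comp φ := by apply Hom.ext; funext; exact Category.id_comp _
  comp_id φ := by apply Hom.ext; funext; exact Category.comp_id _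
  assoc φ ψ χ := by apply Hom.ext; funext; exact Category.assoc _ _ _

variable (E P I)

/-- The canonical descent datum of `e`, given by `f ↦ P(f)(e)`. -/
def canonicalObj (e : P.obj ⟨op I⟩) : DescentDatum E P I where
  obj _ f := (P.map f.op.toLoc).toFunctor.obj e
  iso _ _ g f h w :=
    (Cat.Hom.toNatIso (P.mapComp' f.op.toLoc g.op.toLoc h.op.toLoc (by subst w; rfl))).symm.app e
  iso_id hJ f := by
    have := P.mapComp'_comp_id_inv f.op.toLoc
    have := congrArg (fun t ↦ t.toNatTrans.app e) this
    refine this.trans ?_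
    exact Category.comp_id _
  iso_comp hJ hK hL g g' f h k w w' := by
    have := P.mapComp'₀₁₃_inv f.op.toLoc g.op.toLoc g'.op.toLoc h.op.toLoc (g' ≫ g).op.toLoc
      k.op.toLoc (by subst w; rfl) rfl (by subst w w'; simp)
    have := congrArg (fun t ↦ t.toNatTrans.app e) this
    refine this.trans ?_
    have h₂ := congrArg (fun t ↦ t.hom.toNatTrans.app ((P.map f.op.toLoc).toFunctor.obj e))
      (P.mapComp'_eq_mapComp g.op.toLoc g'.op.toLoc)
    refine Eq.trans ?_ (congrArg (fun t ↦ t ≫ _) h₂)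
    exact congrArg (fun t ↦ _ ≫ t) (Category.id_comp _)

/-- The unit `P ⟶ i_* i^* P` at `I`. -/
def canonical : P.obj ⟨op I⟩ ⥤ DescentDatum E P I where
  obj e := canonicalObj E P I e
  map a :=
    { hom _ f := (P.map f.op.toLoc).toFunctor.map a
      comm hJ hK g f h w :=
        (P.mapComp' f.op.toLoc g.op.toLoc h.op.toLoc
          (by subst w; rfl)).inv.toNatTrans.naturality a }
  map_id _ := by apply Hom.ext; funext; exact CategoryTheory.Functor.map_id _ _
  map_comp _ _ := by apply Hom.ext; funext; exact CategoryTheory.Functor.map_comp _ _ _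

end DescentDatum

/-- `P` is a stack on `(D, E)`: the unit `P ⟶ i_* i^* P` is an equivalence of indexed categories,
that is, an equivalence of categories at each `I`. -/
def IsStackOn : Prop := ∀ I : D, (DescentDatum.canonical E P I).IsEquivalence

end Site

section Indexed
variable {C : Type u} [Category.{v} C]

/-- An indexed topos: the fibers are toposes and the reindexing functors are logical. -/
structure IsIndexedTopos (P : LocallyDiscrete Cᵒᵖ ⥤ᵖ Cat.{v', u'}) : Prop where
  isTopos (I : LocallyDiscrete Cᵒᵖ) : IsTopos (P.obj I)
  isLogical {I J : LocallyDiscrete Cᵒᵖ} (f : I ⟶ J) : IsLogicalFunctor (P.map f).toFunctor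

/-- The indexed full subcategory `Q` of `P` (a family of full subcategories of the fibers of `P`
which is closed under reindexing) is an indexed logical subtopos of `P`: both are indexed toposes,
and each fiber of `Q` is a logical subtopos of the fiber of `P`. -/
structure IsIndexedLogicalSubtopos {P : LocallyDiscrete Cᵒᵖ ⥤ᵖ Cat.{v', u'}}
    (Q : P.ObjectProperty) [Q.IsClosedUnderMapObj] : Prop where
  ambient : IsIndexedTopos P
  sub : IsIndexedTopos Q.fullsubcategory
  fiber (I : LocallyDiscrete Cᵒᵖ) : IsLogicalSubtopos (Q.prop I)

end Indexed

section LocallySmall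
variable {F : Type u} [Category.{v} F]

/-- `p : X ⟶ B` is a locally `E`-small map: for each `A` in `E`, it has along each `f : A ⟶ B`
a pullback whose vertex is in `E`. -/
def IsLocallySmallMap (E : ObjectProperty F) {X B : F} (p : X ⟶ B) : Prop :=
  ∀ ⦃A : F⦄, E A → ∀ f : A ⟶ B, ∃ (Y : F) (fst : Y ⟶ X) (snd : Y ⟶ A),
    E Y ∧ IsPullback fst snd p f

variable [HasPullbacks F]

/-- Locally small maps are stable under pullback. -/
lemma IsLocallySmallMap.pullback {E : ObjectProperty F} {X B A : F} {p : X ⟶ B}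
    (hp : IsLocallySmallMap E p) (f : A ⟶ B) : IsLocallySmallMap E (pullback.snd p f) := by
  intro K hK g
  obtain ⟨Y, a, b, hY, h⟩ := hp hK (g ≫ f)
  have h' := IsPullback.of_hasPullback p f
  exact ⟨Y, h'.lift a (b ≫ g) (by simpa using h.w), b, hY,
    IsPullback.of_right (by simpa using h) (by simp) h'⟩

/-- The indexed full subcategory `(F/(-))_{<E}` of `F/(-)`: its value at `I` is the full
subcategory of `F/I` on the locally `E`-small maps with codomain `I`. -/
def locallySmallMaps (E : ObjectProperty F) : (selfIndexing F).ObjectProperty where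
  prop I := fun p : Over I.as.unop ↦ IsLocallySmallMap E p.hom

instance (E : ObjectProperty F) : (locallySmallMaps E).IsClosedUnderMapObj where
  map_obj hp f := IsLocallySmallMap.pullback hp f.as.unop

end LocallySmall

/-- `E` is a dense logical subtopos of the topos `F`: a logical subtopos such that every object
of `F` is a sheaf on `(F, E)` and the self-indexing of `F` is a stack on `(F, E)`. -/
structure IsDenseLogicalSubtopos {F : Type u} [Category.{v} F] [IsTopos F]
    (E : ObjectProperty F) : Prop where
  isLogicalSubtopos : IsLogicalSubtopos E
  isSheafOn (X : F) : IsSheafOn E (yoneda.obj X)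
  isStackOn : IsStackOn E (selfIndexing F)

end DenseTopos

-- Everything is checked fibrewise, and the heart is the fundamental theorem of topos theory in
-- relative form: for a replete logical subtopos `S` of `F` and `A` in `S`, the objects over `A`
-- with domain in `S` form a logical subtopos of `F/A` (`IsLogicalSubtopos.inverseImage_forget`).
--
-- A map to `I` is locally small iff each pullback to an `A` in `E` has its domain in the replete
-- closure of `E`. Pullback functors are logical, and limits, exponentials and classifiers are
-- unique up to isomorphism. So those computed in `F/I` pull back to ones that the relative theorem
-- places in that closure, and the locally small maps form a logical subtopos of `F/I`
-- (`IsLogicalSubtopos.locallySmallMap`). A replete logical subtopos is itself a topos with logical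
-- inclusion, and logical functors restrict to such subtoposes (`IsLogicalFunctor.lift`); this gives
-- the indexed statement.
--
-- Two adjunctions, forgetting the base with right adjoint `A × -` and composition with right
-- adjoint pullback, are treated at once: their left adjoints are discrete fibrations up to
-- isomorphism, and right adjoints of such functors are logical
-- (`isLogicalFunctor_of_isSliceProjection`). For exponentials in a slice, power objects suffice,
-- since `Z` is an equalizer of maps `Ω ^ Z ⇉ Ω` (`HasExponentialIn.of_power`). The power object of
-- `X` over `A` is the equalizer of the identity and an idempotent, because subobjects of the fibre
-- product are a retract of subobjects of the product (`HasExponentialIn.of_isSliceProjection`).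

universe w₁ w₂ w₃

namespace DenseTopos

/-! ### Binary products by their universal property -/

section Products

variable {D : Type u} [Category.{v} D]

lemma nonempty_isLimit_binaryFan_iff {X Y Q : D} {p : Q ⟶ X} {q : Q ⟶ Y} :
    Nonempty (IsLimit (BinaryFan.mk p q)) ↔
      ∀ ⦃W : D⦄ (a : W ⟶ X) (b : W ⟶ Y), ∃! k : W ⟶ Q, k ≫ p = a ∧ k ≫ q = b := by
  refine ⟨fun ⟨h⟩ W a b ↦ ?_, fun h ↦ ⟨?_⟩⟩
  · obtain ⟨k, hk₁, hk₂⟩ := BinaryFan.IsLimit.lift' h a b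
    exact ⟨k, ⟨hk₁, hk₂⟩, fun k' hk' ↦
      BinaryFan.IsLimit.hom_ext h (hk'.1.trans hk₁.symm) (hk'.2.trans hk₂.symm)⟩
  · choose l hl hl' using h
    exact BinaryFan.isLimitMk (fun s ↦ l s.fst s.snd) (fun s ↦ (hl s.fst s.snd).1)
      (fun s ↦ (hl s.fst s.snd).2) (fun s m h₁ h₂ ↦ hl' _ _ m ⟨h₁, h₂⟩)

lemma nonempty_isLimit_prod_flip [HasBinaryProducts D] (X A : D) :
    Nonempty (IsLimit (BinaryFan.mk (prod.snd : A ⨯ X ⟶ X) prod.fst)) := by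
  rw [nonempty_isLimit_binaryFan_iff]
  refine fun W a b ↦ ⟨prod.lift b a, ⟨prod.lift_snd _ _, prod.lift_fst _ _⟩, ?_⟩
  rintro k ⟨rfl, rfl⟩
  apply prod.hom_ext
  · rw [prod.lift_fst]
  · rw [prod.lift_snd]

end Products

/-! ### Exponentials as representing objects -/

section Representable

variable {D : Type u} [Category.{v} D]

/-- The object `P` represents the presheaf with values `H T` and restriction maps `act`. -/
structure Representation (H : D → Type w₁) (act : ∀ ⦃T T' : D⦄, (T' ⟶ T) → H T → H T')
    (P : D) where
  /-- The natural bijection. -/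
  equiv (T : D) : (T ⟶ P) ≃ H T
  equiv_comp {T T' : D} (f : T' ⟶ T) (g : T ⟶ P) : equiv T' (f ≫ g) = act f (equiv T g)

/-- The presheaf with values `H T` and restriction maps `act` is represented by an object
satisfying `S`. -/
def RepresentableIn (S : ObjectProperty D) (H : D → Type w₁)
    (act : ∀ ⦃T T' : D⦄, (T' ⟶ T) → H T → H T') : Prop :=
  ∃ P : D, S P ∧ Nonempty (Representation H act P)

section

variable {H : D → Type w₁} {act : ∀ ⦃T T' : D⦄, (T' ⟶ T) → H T → H T'}
  {H₁ : D → Type w₂} {act₁ : ∀ ⦃T T' : D⦄, (T' ⟶ T) → H₁ T → H₁ T'}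
  {H₂ : D → Type w₃} {act₂ : ∀ ⦃T T' : D⦄, (T' ⟶ T) → H₂ T → H₂ T'}
  {S : ObjectProperty D}

lemma RepresentableIn.of_equiv (e : ∀ T : D, H T ≃ H₁ T)
    (he : ∀ {T T' : D} (f : T' ⟶ T) (x : H T), e T' (act f x) = act₁ f (e T x))
    (h : RepresentableIn S H act) : RepresentableIn S H₁ act₁ := by
  obtain ⟨P, hP, ⟨r⟩⟩ := h
  exact ⟨P, hP, ⟨{
    equiv T := (r.equiv T).trans (e T)
    equiv_comp f g := by simp [r.equiv_comp, he] }⟩⟩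

/-- If `H` is the equalizer of a pair `a, b : H₁ ⟶ H₂` of morphisms of presheaves, and the
presheaves `H₁` and `H₂` are represented by objects of `S`, then so is `H`. -/
lemma RepresentableIn.of_equalizer [HasEqualizers D]
    [S.IsClosedUnderLimitsOfShape WalkingParallelPair]
    (i : ∀ T : D, H T → H₁ T) (a b : ∀ T : D, H₁ T → H₂ T)
    (hi : ∀ {T T' : D} (f : T' ⟶ T) (x : H T), i T' (act f x) = act₁ f (i T x))
    (ha : ∀ {T T' : D} (f : T' ⟶ T) (x : H₁ T), a T' (act₁ f x) = act₂ f (a T x))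
    (hb : ∀ {T T' : D} (f : T' ⟶ T) (x : H₁ T), b T' (act₁ f x) = act₂ f (b T x))
    (inj : ∀ T, Function.Injective (i T))
    (exact : ∀ T x, (∃ y, i T y = x) ↔ a T x = b T x)
    (h₁ : RepresentableIn S H₁ act₁) (h₂ : RepresentableIn S H₂ act₂) :
    RepresentableIn S H act := by
  obtain ⟨P₁, hP₁, ⟨r₁⟩⟩ := h₁
  obtain ⟨P₂, hP₂, ⟨r₂⟩⟩ := h₂
  -- Yoneda: `α` and `β` are the images of the universal element, so composing with them realises
  -- `a` and `b`.
  let α : P₁ ⟶ P₂ := (r₂.equiv _).symm (a P₁ (r₁.equiv _ (𝟙 P₁)))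
  let β : P₁ ⟶ P₂ := (r₂.equiv _).symm (b P₁ (r₁.equiv _ (𝟙 P₁)))
  have hα {T : D} (f : T ⟶ P₁) : r₂.equiv T (f ≫ α) = a T (r₁.equiv T f) := by
    rw [r₂.equiv_comp, Equiv.apply_symm_apply, ← ha, ← r₁.equiv_comp, Category.comp_id]
  have hβ {T : D} (f : T ⟶ P₁) : r₂.equiv T (f ≫ β) = b T (r₁.equiv T f) := by
    rw [r₂.equiv_comp, Equiv.apply_symm_apply, ← hb, ← r₁.equiv_comp, Category.comp_id]
  have key (T : D) (f : T ⟶ equalizer α β) :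
      ∃ y, i T y = r₁.equiv T (f ≫ equalizer.ι α β) := by
    rw [exact, ← hα, ← hβ, Category.assoc, Category.assoc, equalizer.condition]
  choose φ hφ using key
  refine ⟨equalizer α β, S.prop_limit _ (by rintro (_ | _) <;> assumption), ⟨{
    equiv T := Equiv.ofBijective (φ T) ⟨fun f g h ↦ ?_, fun y ↦ ?_⟩
    equiv_comp {T T'} f g := ?_ }⟩⟩
  · have := congrArg (i T) h
    rw [hφ, hφ] at this
    exact equalizer.hom_ext ((r₁.equiv T).injective this)
  · have h : (r₁.equiv T).symm (i T y) ≫ α = (r₁.equiv T).symm (i T y) ≫ β := by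
      apply (r₂.equiv T).injective
      rw [hα, hβ, Equiv.apply_symm_apply, ← exact]
      exact ⟨y, rfl⟩
    refine ⟨equalizer.lift _ h, inj T ?_⟩
    rw [hφ, equalizer.lift_ι, Equiv.apply_symm_apply]
  · apply inj
    change i T' (φ T' (f ≫ g)) = i T' (act f (φ T g))
    rw [hφ, hi, hφ, Category.assoc, r₁.equiv_comp]

end

variable [HasBinaryProducts D]

/-- A representation of the presheaf `T ↦ Hom (A ⨯ T, B)` by `P`. -/
abbrev ExponentialRepresentation (A B P : D) :=
  Representation (fun T ↦ A ⨯ T ⟶ B) (fun _ _ f x ↦ prod.map (𝟙 A) f ≫ x) P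

/-- The presheaf `T ↦ Hom (A ⨯ T, B)` is represented by an object of `S`. -/
abbrev HasExponentialIn (S : ObjectProperty D) (A B : D) : Prop :=
  RepresentableIn S (fun T ↦ A ⨯ T ⟶ B) (fun _ _ f x ↦ prod.map (𝟙 A) f ≫ x)

/-- With the next lemma, this trades the choice-free definition, which ranges over all product
cones, for representability with chosen products. Here only the cones on `A ⨯ T` are needed. -/
lemma IsExponential.nonempty_representation {A B P Q : D} {fst : Q ⟶ P} {snd : Q ⟶ A}
    {ev : Q ⟶ B} (h : IsExponential fst snd ev) : Nonempty (ExponentialRepresentation A B P) := by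
  obtain ⟨hQ, h⟩ := h
  rw [nonempty_isLimit_binaryFan_iff] at hQ
  choose κ hκ hκ' using fun (T : D) (f : T ⟶ P) ↦ hQ (prod.snd (X := A) ≫ f) prod.fst
  refine ⟨{
    equiv T := Equiv.ofBijective (fun f ↦ κ T f ≫ ev) ⟨fun f g hfg ↦ ?_, fun y ↦ ?_⟩
    equiv_comp {T T'} f g := ?_ }⟩
  · exact (h _ _ (nonempty_isLimit_prod_flip T A) (κ T g ≫ ev)).unique
      ⟨κ T f, (hκ T f).1, (hκ T f).2, hfg⟩ ⟨κ T g, (hκ T g).1, (hκ T g).2, rfl⟩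
  · obtain ⟨f, ⟨k, hk₁, hk₂, hk₃⟩, -⟩ := h _ _ (nonempty_isLimit_prod_flip T A) y
    exact ⟨f, by rw [← hk₃, hκ' T f k ⟨hk₁, hk₂⟩]⟩
  · change κ T' (f ≫ g) ≫ ev = prod.map (𝟙 A) f ≫ κ T g ≫ ev
    rw [← hκ' T' (f ≫ g) (prod.map (𝟙 A) f ≫ κ T g) ⟨by simp [hκ], by simp [hκ]⟩, Category.assoc]

lemma isExponential_of_representation {A B P : D} (r : ExponentialRepresentation A B P) :
    IsExponential (prod.snd : A ⨯ P ⟶ P) prod.fst (r.equiv P (𝟙 P)) := by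
  have hr {T : D} (f : T ⟶ P) : prod.map (𝟙 A) f ≫ r.equiv P (𝟙 P) = r.equiv T f :=
    (r.equiv_comp f (𝟙 P)).symm.trans (by rw [Category.comp_id])
  refine ⟨nonempty_isLimit_prod_flip P A, ?_⟩
  intro X Y p q hY g
  rw [nonempty_isLimit_binaryFan_iff] at hY
  -- Comparison from the chosen product to the given one; only the identity `he` is needed to
  -- transport the universal property.
  obtain ⟨e, ⟨e₁, e₂⟩, -⟩ := hY (prod.snd : A ⨯ X ⟶ X) prod.fst
  have he : prod.lift q p ≫ e = 𝟙 Y :=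
    (hY p q).unique ⟨by rw [Category.assoc, e₁, prod.lift_snd],
      by rw [Category.assoc, e₂, prod.lift_fst]⟩ ⟨by rw [Category.id_comp], by rw [Category.id_comp]⟩
  have hk {f : X ⟶ P} {k : Y ⟶ A ⨯ P} (h₁ : k ≫ prod.snd = p ≫ f) (h₂ : k ≫ prod.fst = q) :
      e ≫ k = prod.map (𝟙 A) f := by
    ext
    · rw [Category.assoc, h₂, e₂, prod.map_fst, Category.comp_id]
    · rw [Category.assoc, h₁, ← Category.assoc, e₁, prod.map_snd]
  refine ⟨(r.equiv X).symm (e ≫ g), ⟨prod.lift q (p ≫ (r.equiv X).symm (e ≫ g)),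
    prod.lift_snd _ _, prod.lift_fst _ _, ?_⟩, ?_⟩
  · rw [← Category.id_comp (_ ≫ r.equiv _ _), ← he, Category.assoc, ← Category.assoc e,
      hk (prod.lift_snd _ _) (prod.lift_fst _ _), hr, Equiv.apply_symm_apply,
      ← Category.assoc, he, Category.id_comp]
  · rintro f ⟨k, h₁, h₂, rfl⟩
    rw [← Category.assoc, hk h₁ h₂, hr, Equiv.symm_apply_apply]

lemma HasExponentialIn.exists_isExponential {S : ObjectProperty D} {A B : D}
    (h : HasExponentialIn S A B) :
    ∃ (P Q : D) (fst : Q ⟶ P) (snd : Q ⟶ A) (ev : Q ⟶ B), IsExponential fst snd ev ∧ S P := by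
  obtain ⟨P, hP, ⟨r⟩⟩ := h
  exact ⟨P, _, _, _, _, isExponential_of_representation r, hP⟩

end Representable

/-! ### Exponentials from power objects via the singleton map -/

section SingletonMap

variable {D : Type u} [Category.{v} D] [HasFiniteLimits D] (c : Subobject.Classifier D)

/-- The exponentials `(W ^ Z) ^ X` are the exponentials `W ^ (Z ⨯ X)`. -/
lemma HasExponentialIn.of_representation {S : ObjectProperty D} {X Z W P : D}
    (r : ExponentialRepresentation Z W P) (h : HasExponentialIn S (Z ⨯ X) W) :
    HasExponentialIn S X P := by
  refine h.of_equiv (fun T ↦ ((prod.associator Z X T).homFromEquiv).trans (r.equiv _).symm)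
    fun f x ↦ ?_
  apply (r.equiv _).injective
  simp only [Equiv.trans_apply]
  rw [r.equiv_comp]
  simp only [Equiv.apply_symm_apply, Iso.homFromEquiv_apply]
  rw [← Category.assoc, ← Category.assoc]
  congr 1
  ext <;> simp

variable {c} in
/-- The singleton map `Z ⟶ Ω ^ Z` is a monomorphism. -/
lemma mono_singleton {Z P : D} (r : ExponentialRepresentation Z c.Ω P) :
    Mono ((r.equiv Z).symm (c.χ (prod.lift (𝟙 Z) (𝟙 Z)))) := by
  refine ⟨fun {T} f g h ↦ ?_⟩
  replace h := congrArg (r.equiv T) h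
  rw [r.equiv_comp, r.equiv_comp, Equiv.apply_symm_apply] at h
  -- Restricting to the graph of `f` gives `χ_Δ (f, f) = χ_Δ (f, g)`. The left side is true, so `(f,
  -- g)` factors through the diagonal.
  replace h := congrArg (prod.lift f (𝟙 T) ≫ ·) h
  simp only [← Category.assoc] at h
  simp only [prod.lift_map, Category.comp_id, Category.id_comp] at h
  have w : prod.lift f g ≫ c.χ (prod.lift (𝟙 Z) (𝟙 Z)) = c.χ₀ T ≫ c.truth := by
    have h' : prod.lift f f = f ≫ prod.lift (𝟙 Z) (𝟙 Z) := by ext <;> simp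
    rw [← h, h', Category.assoc, (c.isPullback _).w, ← Category.assoc]
    congr 1
    exact Subsingleton.elim _ _
  have hl := (c.isPullback (prod.lift (𝟙 Z) (𝟙 Z))).lift_fst _ _ w
  have h₁ := congrArg (· ≫ prod.fst) hl
  have h₂ := congrArg (· ≫ prod.snd) hl
  simp only [Category.assoc, prod.lift_fst, prod.lift_snd, Category.comp_id] at h₁ h₂
  exact h₁.symm.trans h₂

/-- If `S` contains all power objects of its objects, and is closed under equalizers and binary
products, then it has all exponentials. -/
theorem HasExponentialIn.of_power {S : ObjectProperty D}
    [S.IsClosedUnderLimitsOfShape WalkingParallelPair]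
    [S.IsClosedUnderLimitsOfShape (Discrete WalkingPair)]
    (h : ∀ X, S X → HasExponentialIn S X c.Ω) {X Z : D} (hX : S X) (hZ : S Z) :
    HasExponentialIn S X Z := by
  obtain ⟨P, hP, ⟨r⟩⟩ := h Z hZ
  have := mono_singleton r
  set σ := (r.equiv Z).symm (c.χ (prod.lift (𝟙 Z) (𝟙 Z)))
  have hZX : S (Z ⨯ X) := S.prop_limit _ (by rintro ⟨_ | _⟩ <;> assumption)
  -- Since `σ` is mono, `Z` is the equalizer of `χ σ` and the constant map true on `P = Ω ^ Z`.
  -- Raising to the power `X` exhibits `Z ^ X` as an equalizer of maps `Ω ^ (Z ⨯ X) ⇉ Ω ^ X`.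
  refine .of_equalizer (H₁ := fun T ↦ X ⨯ T ⟶ P) (H₂ := fun T ↦ X ⨯ T ⟶ c.Ω)
    (fun T f ↦ f ≫ σ) (fun T f ↦ f ≫ c.χ σ) (fun T f ↦ c.χ₀ _ ≫ c.truth)
    (fun f x ↦ Category.assoc _ _ _)
    (fun f x ↦ Category.assoc _ _ _) (fun f x ↦ ?_) (fun T f g h ↦ (cancel_mono σ).1 h)
    (fun T f ↦ ⟨?_, fun h ↦ ⟨(c.isPullback σ).lift f (c.χ₀ _) h, (c.isPullback σ).lift_fst _ _ _⟩⟩)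
    (HasExponentialIn.of_representation r (h _ hZX)) (h _ hX)
  · rw [← Category.assoc]
    congr 1
    exact Subsingleton.elim _ _
  · rintro ⟨g, rfl⟩
    rw [Category.assoc, (c.isPullback σ).w, ← Category.assoc]
    congr 1
    exact Subsingleton.elim _ _

end SingletonMap

/-- Uniqueness of lifts is automatic because `fst` is a monomorphism. -/
lemma isPullback_of_mono {C : Type u} [Category.{v} C] {P X Y Z : C} {fst : P ⟶ X} {snd : P ⟶ Y}
    {f : X ⟶ Z} {g : Y ⟶ Z} [Mono fst] (w : fst ≫ f = snd ≫ g)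
    (h : ∀ ⦃W : C⦄ (a : W ⟶ X) (b : W ⟶ Y), a ≫ f = b ≫ g →
      ∃ l : W ⟶ P, l ≫ fst = a ∧ l ≫ snd = b) : IsPullback fst snd f g := by
  choose l hl hl' using h
  exact ⟨⟨w⟩, ⟨PullbackCone.IsLimit.mk w (fun s ↦ l _ _ s.condition) (fun s ↦ hl _ _ s.condition)
    (fun s ↦ hl' _ _ s.condition) (fun s m hm _ ↦ by
      rw [← cancel_mono fst, hm, hl])⟩⟩

/-! ### Direct images of subobjects along monomorphisms -/

section Extension

variable {D : Type u} [Category.{v} D] [HasPullbacks D] (c : Subobject.Classifier D)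

/-- The direct image of the subobject classified by `φ` along the monomorphism `m`. -/
noncomputable def directImage {V W : D} (m : V ⟶ W) [Mono m] (φ : V ⟶ c.Ω) : W ⟶ c.Ω :=
  c.χ (pullback.fst φ c.truth ≫ m)

/-- The Beck-Chevalley condition for direct images. -/
lemma comp_directImage {V W V' W' : D} {f' : V' ⟶ V} {m' : V' ⟶ W'} {m : V ⟶ W} {f : W' ⟶ W}
    [Mono m] [Mono m'] (h : IsPullback f' m' m f) (φ : V ⟶ c.Ω) :
    f ≫ directImage c m φ = directImage c m' (f' ≫ φ) := by
  have hφ := (IsPullback.of_hasPullback φ c.truth).flip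
  have hφ' := (IsPullback.of_hasPullback (f' ≫ φ) c.truth).flip
  have w : (pullback.fst (f' ≫ φ) c.truth ≫ f') ≫ φ =
      pullback.snd (f' ≫ φ) c.truth ≫ c.truth := by
    rw [Category.assoc, pullback.condition]
  have hU : IsPullback (pullback.lift (pullback.fst (f' ≫ φ) c.truth ≫ f')
      (pullback.snd (f' ≫ φ) c.truth) w) (pullback.fst (f' ≫ φ) c.truth)
      (pullback.fst φ c.truth) f' :=
    IsPullback.of_right (by rwa [pullback.lift_snd]) (pullback.lift_fst _ _ _) hφ
  exact c.uniq _ ((hU.paste_vert h).paste_horiz (c.isPullback (pullback.fst φ c.truth ≫ m)).flip).flip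

/-- Beck-Chevalley for the square with two identity sides, which is a pullback exactly because `m`
is mono. -/
lemma self_comp_directImage {V W : D} (m : V ⟶ W) [Mono m] (φ : V ⟶ c.Ω) :
    m ≫ directImage c m φ = φ := by
  rw [comp_directImage c (f' := 𝟙 V) (m' := 𝟙 V) (IsKernelPair.id_of_mono m), Category.id_comp]
  exact (c.uniq _ (χ₀' := pullback.snd φ c.truth)
    (by simpa using IsPullback.of_hasPullback φ c.truth)).symm

end Extension

/-- A functor `L` which behaves like the projection `D / A ⥤ D`: a discrete fibration, up to
isomorphisms of objects. -/
structure IsSliceProjection {C : Type u} [Category.{v} C] {D : Type u'} [Category.{v'} D]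
    (L : C ⥤ D) : Prop where
  faithful : L.Faithful
  exists_hom {T U X : C} (x : T ⟶ X) (m : U ⟶ X) (w : L.obj T ⟶ L.obj U) :
    w ≫ L.map m = L.map x → ∃ w' : T ⟶ U, L.map w' = w
  exists_obj {W : D} {X : C} (w : W ⟶ L.obj X) :
    ∃ (T : C) (e : L.obj T ≅ W) (x : T ⟶ X), e.hom ≫ w = L.map x

lemma isSliceProjection_forget {D : Type u} [Category.{v} D] (A : D) :
    IsSliceProjection (Over.forget A) where
  faithful := inferInstance
  exists_hom {T U X} x m w h :=
    ⟨Over.homMk w (by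
      rw [← Over.w m, ← Over.w x]
      exact (Category.assoc _ _ _).symm.trans (congrArg (fun t ↦ t ≫ X.hom) h)), rfl⟩
  exists_obj {W X} w := ⟨Over.mk (w ≫ X.hom), Iso.refl W, Over.homMk w, Category.id_comp _⟩

lemma isSliceProjection_map {D : Type u} [Category.{v} D] {A B : D} (f : A ⟶ B) :
    IsSliceProjection (Over.map f) where
  faithful := ⟨fun {X Y} a b h ↦ by
    ext
    exact congrArg (fun t ↦ t.left) h⟩
  exists_hom {T U X} x m w h :=
    ⟨Over.homMk w.left (by
      rw [← Over.w m, ← Over.w x]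
      exact (Category.assoc _ _ _).symm.trans
        (congrArg (fun t ↦ t.left ≫ X.hom) h)), rfl⟩
  exists_obj {W X} w :=
    ⟨Over.mk (w.left ≫ X.hom), Over.isoMk (Iso.refl _) (by
      have := Over.w w
      simpa using this.symm), Over.homMk w.left, by ext; simp⟩

/-! ### Monomorphisms and products under a slice projection -/

namespace IsSliceProjection

variable {C : Type u} [Category.{v} C] {D : Type u'} [Category.{v'} D] {L : C ⥤ D}
  (hL : IsSliceProjection L)

include hL

/-- Two maps with the same composite with `L.map m` lift together: that composite determines a lift
of their common domain. -/
lemma mono_map {U X : C} (m : U ⟶ X) [Mono m] : Mono (L.map m) := by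
  have := hL.faithful
  refine ⟨fun {W} a b h ↦ ?_⟩
  obtain ⟨T, e, x, hx⟩ := hL.exists_obj (a ≫ L.map m)
  obtain ⟨a', ha⟩ := hL.exists_hom x m (e.hom ≫ a) (by rw [Category.assoc, hx])
  obtain ⟨b', hb⟩ := hL.exists_hom x m (e.hom ≫ b) (by rw [Category.assoc, ← h, hx])
  have : a' = b' := by
    rw [← cancel_mono m]
    apply L.map_injective
    rw [L.map_comp, L.map_comp, ha, hb, Category.assoc, Category.assoc, h]
  rw [← cancel_epi e.hom, ← ha, ← hb, this]

variable [HasBinaryProducts C] [HasBinaryProducts D]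

/-- In the model case this is the inclusion of `X ×_A T` into `X × T`. -/
lemma mono_prodComparison (X T : C) : Mono (prodComparison L X T) := by
  have := hL.faithful
  refine ⟨fun {W} a b h ↦ ?_⟩
  have h₁ : a ≫ L.map prod.fst = b ≫ L.map prod.fst := by
    simpa using congrArg (· ≫ prod.fst) h
  have h₂ : a ≫ L.map prod.snd = b ≫ L.map prod.snd := by
    simpa using congrArg (· ≫ prod.snd) h
  obtain ⟨V, e, x, hx⟩ := hL.exists_obj (a ≫ L.map (prod.fst : X ⨯ T ⟶ X))
  obtain ⟨a', ha⟩ := hL.exists_hom x prod.fst (e.hom ≫ a) (by rw [Category.assoc, hx])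
  obtain ⟨b', hb⟩ := hL.exists_hom x prod.fst (e.hom ≫ b) (by rw [Category.assoc, ← h₁, hx])
  have : a' = b' := by
    apply prod.hom_ext <;> apply L.map_injective <;>
      simp only [L.map_comp, ha, hb, Category.assoc, h₁, h₂]
  rw [← cancel_epi e.hom, ← ha, ← hb, this]

/-- A pair in `X × T'` agrees over `A` iff its image in `X × T` does, as `f` lies over `A`. This
makes direct image along the comparison natural in `T`. -/
lemma isPullback_prodComparison (X : C) {T T' : C} (f : T' ⟶ T) :
    IsPullback (L.map (prod.map (𝟙 X) f)) (prodComparison L X T') (prodComparison L X T)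
      (prod.map (𝟙 (L.obj X)) (L.map f)) := by
  have := hL.mono_prodComparison X T'
  have w : L.map (prod.map (𝟙 X) f) ≫ prodComparison L X T =
      prodComparison L X T' ≫ prod.map (𝟙 (L.obj X)) (L.map f) := by
    rw [prodComparison_natural, L.map_id]
  refine (isPullback_of_mono w.symm fun W b₀ a₀ hab ↦ ?_).flip
  have h₁ : a₀ ≫ L.map prod.fst = b₀ ≫ prod.fst := by
    simpa using congrArg (· ≫ prod.fst) hab.symm
  have h₂ : a₀ ≫ L.map prod.snd = b₀ ≫ prod.snd ≫ L.map f := by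
    simpa using congrArg (· ≫ prod.snd) hab.symm
  obtain ⟨V, e, x, hx⟩ := hL.exists_obj (a₀ ≫ L.map (prod.fst : X ⨯ T ⟶ X))
  obtain ⟨a, ha⟩ := hL.exists_hom x prod.fst (e.hom ≫ a₀) (by rw [Category.assoc, hx])
  obtain ⟨t, ht⟩ := hL.exists_hom (a ≫ prod.snd) f (e.hom ≫ b₀ ≫ prod.snd)
    (by rw [L.map_comp, ha, Category.assoc, Category.assoc, Category.assoc, h₂])
  have hl : e.inv ≫ L.map (prod.lift x t) ≫ prodComparison L X T' = b₀ := by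
    rw [Iso.inv_comp_eq]
    apply prod.hom_ext
    · rw [Category.assoc, prodComparison_fst, ← L.map_comp, prod.lift_fst, ← hx, h₁,
        Category.assoc]
    · rw [Category.assoc, prodComparison_snd, ← L.map_comp, prod.lift_snd, ht, Category.assoc]
  have := hL.mono_prodComparison X T
  refine ⟨e.inv ≫ L.map (prod.lift x t), by rw [Category.assoc, hl], ?_⟩
  rw [← cancel_mono (prodComparison L X T), Category.assoc, Category.assoc, w, ← hab, ← hl]
  simp only [Category.assoc]

end IsSliceProjection

/-! ### Right adjoints of slice projections are logical -/

section RightAdjoint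

variable {C : Type u} [Category.{v} C] {D : Type u'} [Category.{v'} D] {L : C ⥤ D} {G : D ⥤ C}

open IsSliceProjection in
/-- The power object of `X` in a slice is carved out of the power object of `L X`, because
the subobjects of `X ⨯ T` are a retract of the subobjects of `L X ⨯ L T`. -/
theorem HasExponentialIn.of_isSliceProjection [HasFiniteLimits C] [HasFiniteLimits D]
    (adj : L ⊣ G) (hL : IsSliceProjection L) (c : Subobject.Classifier D)
    {S : ObjectProperty C} [S.IsClosedUnderLimitsOfShape WalkingParallelPair]
    {S₀ : ObjectProperty D} (hS : ∀ Y, S₀ Y → S (G.obj Y)) {X : C}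
    (h : HasExponentialIn S₀ (L.obj X) c.Ω) : HasExponentialIn S X (G.obj c.Ω) := by
  obtain ⟨P, hP, ⟨r⟩⟩ := h
  have hm := hL.mono_prodComparison X
  -- The larger presheaf, subobjects of `L X ⨯ L T`, is represented by `G P` through the adjunction.
  have h₁ : RepresentableIn S (fun T ↦ L.obj X ⨯ L.obj T ⟶ c.Ω)
      (fun _ _ f x ↦ prod.map (𝟙 _) (L.map f) ≫ x) :=
    ⟨G.obj P, hS _ hP, ⟨{
      equiv T := (adj.homEquiv T P).symm.trans (r.equiv _)
      equiv_comp f g := by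
        simp only [Equiv.trans_apply]
        rw [adj.homEquiv_naturality_left_symm, r.equiv_comp] }⟩⟩
  -- Direct image along the comparison `m` is split by restriction along `m`, so its image is the
  -- set of fixed points of the idempotent restrict-then-extend.
  refine .of_equalizer
    (fun T y ↦ directImage c (prodComparison L X T) ((adj.homEquiv _ _).symm y))
    (fun T x ↦ directImage c (prodComparison L X T) (prodComparison L X T ≫ x))
    (fun T x ↦ x) (fun f x ↦ ?_) (fun f x ↦ ?_) (fun f x ↦ rfl) (fun T x y hxy ↦ ?_)
    (fun T x ↦ ⟨?_, fun hx ↦ ⟨adj.homEquiv _ _ (prodComparison L X T ≫ x), ?_⟩⟩) h₁ h₁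
  · rw [comp_directImage c (hL.isPullback_prodComparison X f), adj.homEquiv_naturality_left_symm]
  · rw [comp_directImage c (hL.isPullback_prodComparison X f), ← Category.assoc,
      ← (hL.isPullback_prodComparison X f).w, Category.assoc]
  · have := congrArg (prodComparison L X T ≫ ·) hxy
    simp only [self_comp_directImage] at this
    exact (adj.homEquiv _ _).symm.injective this
  · rintro ⟨y, rfl⟩
    rw [self_comp_directImage]
  · rw [Equiv.symm_apply_apply, hx]

variable (adj : L ⊣ G) (hL : IsSliceProjection L)
include hL

/-- Frobenius reciprocity. -/
lemma IsSliceProjection.nonempty_isLimit_binaryFan {X Y : C} {A : D} {p : Y ⟶ X}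
    {q : Y ⟶ G.obj A} (h : Nonempty (IsLimit (BinaryFan.mk p q))) :
    Nonempty (IsLimit (BinaryFan.mk (L.map p) ((adj.homEquiv Y A).symm q))) := by
  have := hL.faithful
  rw [nonempty_isLimit_binaryFan_iff] at h ⊢
  intro W a b
  obtain ⟨T, e, x, hx⟩ := hL.exists_obj a
  obtain ⟨k, ⟨hk₁, hk₂⟩, hk⟩ := h x (adj.homEquiv T A (e.hom ≫ b))
  refine ⟨e.inv ≫ L.map k, ⟨?_, ?_⟩, ?_⟩
  · rw [Category.assoc, ← L.map_comp, hk₁, ← hx, Iso.inv_hom_id_assoc]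
  · rw [Category.assoc, ← adj.homEquiv_naturality_left_symm, hk₂, Equiv.symm_apply_apply,
      Iso.inv_hom_id_assoc]
  · rintro k' ⟨hk₁', hk₂'⟩
    obtain ⟨k'', hk''⟩ := hL.exists_hom x p (e.hom ≫ k') (by rw [Category.assoc, hk₁', hx])
    have : k'' = k := by
      refine hk k'' ⟨L.map_injective ?_, (adj.homEquiv _ _).symm.injective ?_⟩
      · rw [L.map_comp, hk'', Category.assoc, hk₁', hx]
      · rw [adj.homEquiv_naturality_left_symm, hk'', Category.assoc, hk₂', Equiv.symm_apply_apply]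
    rw [← this, hk'', Iso.inv_hom_id_assoc]

include adj

/-- By Frobenius a product of `X` with `G A` transposes to a product of `L X` with `A`, where the
given universal property applies. -/
lemma IsExponential.map_of_isSliceProjection {A B P Q : D} {fst : Q ⟶ P} {snd : Q ⟶ A}
    {ev : Q ⟶ B} (h : IsExponential fst snd ev) :
    IsExponential (G.map fst) (G.map snd) (G.map ev) := by
  have : PreservesLimitsOfSize.{0, 0} G := adj.rightAdjoint_preservesLimits
  refine ⟨h.1.map (mapIsLimitOfPreservesOfIsLimit G _ _), fun X Y p q hpq g ↦ ?_⟩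
  obtain ⟨k, ⟨l, hl₁, hl₂, hl₃⟩, hk⟩ := h.2 _ _ (hL.nonempty_isLimit_binaryFan adj hpq)
    ((adj.homEquiv _ _).symm g)
  refine ⟨adj.homEquiv _ _ k, ⟨adj.homEquiv _ _ l, ?_, ?_, ?_⟩, ?_⟩
  · rw [← adj.homEquiv_naturality_right, hl₁, adj.homEquiv_naturality_left]
  · rw [← adj.homEquiv_naturality_right, hl₂, Equiv.apply_symm_apply]
  · rw [← adj.homEquiv_naturality_right, hl₃, Equiv.apply_symm_apply]
  · rintro k' ⟨l', hl₁', hl₂', hl₃'⟩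
    rw [← Equiv.symm_apply_eq]
    refine hk _ ⟨(adj.homEquiv _ _).symm l', ?_, ?_, ?_⟩
    · rw [← adj.homEquiv_naturality_right_symm, hl₁', adj.homEquiv_naturality_left_symm]
    · rw [← adj.homEquiv_naturality_right_symm, hl₂']
    · rw [← adj.homEquiv_naturality_right_symm, hl₃']

/-- Commutative squares transpose along the adjunction. As `m` and `t` are monomorphisms, it only
remains to lift test maps through `m`, respectively `L.map m`. -/
lemma IsSliceProjection.isPullback_iff {U X : C} {Ω₀ Ω : D} (m : U ⟶ X) [Mono m]
    (a : L.obj U ⟶ Ω₀) (χ : L.obj X ⟶ Ω) (t : Ω₀ ⟶ Ω) [Mono t] :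
    IsPullback (L.map m) a χ t ↔
      IsPullback m (adj.homEquiv _ _ a) (adj.homEquiv _ _ χ) (G.map t) := by
  have := hL.faithful
  have := hL.mono_map m
  have hw : L.map m ≫ χ = a ≫ t ↔
      m ≫ adj.homEquiv _ _ χ = adj.homEquiv _ _ a ≫ G.map t := by
    rw [← adj.homEquiv_naturality_left, ← adj.homEquiv_naturality_right]
    exact (adj.homEquiv _ _).injective.eq_iff.symm
  have : PreservesLimitsOfSize.{0, 0} G := adj.rightAdjoint_preservesLimits
  constructor
  · refine fun h ↦ isPullback_of_mono (hw.1 h.w) fun T x y hxy ↦ ?_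
    have w : L.map x ≫ χ = (adj.homEquiv _ _).symm y ≫ t := by
      apply (adj.homEquiv _ _).injective
      rw [adj.homEquiv_naturality_left, adj.homEquiv_naturality_right, Equiv.apply_symm_apply, hxy]
    obtain ⟨l, hl⟩ := hL.exists_hom x m (h.lift _ _ w) (h.lift_fst _ _ w)
    have hl' : l ≫ m = x := L.map_injective (by rw [L.map_comp, hl, h.lift_fst])
    refine ⟨l, hl', ?_⟩
    rw [← cancel_mono (G.map t), Category.assoc, ← hw.1 h.w, ← Category.assoc, hl', hxy]
  · refine fun h ↦ isPullback_of_mono (hw.2 h.w) fun W x y hxy ↦ ?_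
    obtain ⟨T, e, x', hx⟩ := hL.exists_obj x
    obtain ⟨l, hl, -⟩ := h.exists_lift x' (adj.homEquiv _ _ (e.hom ≫ y)) (by
      rw [← adj.homEquiv_naturality_left, ← adj.homEquiv_naturality_right, ← hx, Category.assoc,
        Category.assoc, hxy])
    have hl' : (e.inv ≫ L.map l) ≫ L.map m = x := by
      rw [Category.assoc, ← L.map_comp, hl, ← hx, Iso.inv_hom_id_assoc]
    refine ⟨e.inv ≫ L.map l, hl', ?_⟩
    rw [← cancel_mono t, Category.assoc, ← hw.2 h.w, ← Category.assoc, hl', hxy]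

lemma IsSubobjectClassifier.map_of_isSliceProjection {Ω₀ Ω : D} {t : Ω₀ ⟶ Ω}
    (h : IsSubobjectClassifier t) : IsSubobjectClassifier (G.map t) := by
  have : PreservesLimitsOfSize.{0, 0} G := adj.rightAdjoint_preservesLimits
  obtain ⟨⟨h₀⟩, h⟩ := h
  have : Mono t := h₀.mono_from _
  refine ⟨⟨h₀.isTerminalObj G⟩, fun U X m _ ↦ ?_⟩
  have := hL.mono_map m
  obtain ⟨χ, ⟨χ₀, hχ⟩, uniq⟩ := h (L.map m)
  refine ⟨_, ⟨_, (hL.isPullback_iff adj m χ₀ χ t).1 hχ⟩, ?_⟩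
  rintro χ' ⟨χ₀', hχ'⟩
  rw [← Equiv.symm_apply_eq]
  refine uniq _ ⟨(adj.homEquiv _ _).symm χ₀', (hL.isPullback_iff adj m _ _ t).2 ?_⟩
  rwa [Equiv.apply_symm_apply, Equiv.apply_symm_apply]

/-- A right adjoint of a slice projection is logical. -/
theorem isLogicalFunctor_of_isSliceProjection : IsLogicalFunctor G where
  preservesFiniteLimits :=
    have : PreservesLimitsOfSize.{0, 0} G := adj.rightAdjoint_preservesLimits
    PreservesLimitsOfSize0.preservesFiniteLimits G
  map_exponential _ _ _ h := h.map_of_isSliceProjection adj hL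
  map_classifier c := (isSubobjectClassifier_truth c).map_of_isSliceProjection adj hL

end RightAdjoint

/-! ### Uniqueness of exponentials and classifiers up to isomorphism -/

section Uniqueness

variable {C : Type u} [Category.{v} C]

lemma IsExponential.of_iso {A B P Q P' Q' : C} {fst : Q ⟶ P} {snd : Q ⟶ A} {ev : Q ⟶ B}
    {fst' : Q' ⟶ P'} {snd' : Q' ⟶ A} {ev' : Q' ⟶ B} (h : IsExponential fst' snd' ev')
    (eP : P ≅ P') (eQ : Q ≅ Q') (h₁ : eQ.hom ≫ fst' = fst ≫ eP.hom) (h₂ : eQ.hom ≫ snd' = snd)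
    (h₃ : eQ.hom ≫ ev' = ev) : IsExponential fst snd ev := by
  have h₁' : eQ.inv ≫ fst = fst' ≫ eP.inv := by
    rw [Iso.inv_comp_eq, ← Category.assoc, h₁, Category.assoc, Iso.hom_inv_id, Category.comp_id]
  obtain ⟨hQ, h⟩ := h
  rw [nonempty_isLimit_binaryFan_iff] at hQ
  refine ⟨nonempty_isLimit_binaryFan_iff.2 fun W a b ↦ ?_, fun X Y p q hpq g ↦ ?_⟩
  · obtain ⟨k, ⟨hk₁, hk₂⟩, hk⟩ := hQ (a ≫ eP.hom) b
    refine ⟨k ≫ eQ.inv, ⟨?_, ?_⟩, ?_⟩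
    · rw [Category.assoc, h₁', ← Category.assoc, hk₁, Category.assoc, Iso.hom_inv_id,
        Category.comp_id]
    · rw [Category.assoc, ← h₂, Iso.inv_hom_id_assoc, hk₂]
    · rintro k' ⟨rfl, rfl⟩
      rw [Iso.eq_comp_inv]
      exact hk _ ⟨by rw [Category.assoc, h₁, Category.assoc], by rw [Category.assoc, h₂]⟩
  · obtain ⟨f, ⟨k, hk₁, hk₂, hk₃⟩, hf⟩ := h p q hpq g
    refine ⟨f ≫ eP.inv, ⟨k ≫ eQ.inv, ?_, ?_, ?_⟩, ?_⟩
    · rw [Category.assoc, h₁', ← Category.assoc, hk₁, Category.assoc]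
    · rw [Category.assoc, ← h₂, Iso.inv_hom_id_assoc, hk₂]
    · rw [Category.assoc, ← h₃, Iso.inv_hom_id_assoc, hk₃]
    · rintro f' ⟨k', hk₁', hk₂', hk₃'⟩
      rw [Iso.eq_comp_inv]
      refine hf _ ⟨k' ≫ eQ.hom, ?_, ?_, ?_⟩
      · rw [Category.assoc, h₁, ← Category.assoc, hk₁', Category.assoc]
      · rw [Category.assoc, h₂, hk₂']
      · rw [Category.assoc, h₃, hk₃']

lemma IsExponential.exists_iso {A B P Q P' Q' : C} {fst : Q ⟶ P} {snd : Q ⟶ A} {ev : Q ⟶ B}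
    {fst' : Q' ⟶ P'} {snd' : Q' ⟶ A} {ev' : Q' ⟶ B} (h : IsExponential fst snd ev)
    (h' : IsExponential fst' snd' ev') :
    ∃ (eP : P ≅ P') (eQ : Q ≅ Q'), eQ.hom ≫ fst' = fst ≫ eP.hom ∧ eQ.hom ≫ snd' = snd ∧
      eQ.hom ≫ ev' = ev := by
  have aux {P Q P' Q' : C} {fst : Q ⟶ P} {snd : Q ⟶ A} {ev : Q ⟶ B}
      {fst' : Q' ⟶ P'} {snd' : Q' ⟶ A} {ev' : Q' ⟶ B} (h : IsExponential fst snd ev)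
      {f : P ⟶ P'} {k : Q ⟶ Q'} (hk₁ : k ≫ fst' = fst ≫ f) (hk₂ : k ≫ snd' = snd)
      (hk₃ : k ≫ ev' = ev) {g : P' ⟶ P} {l : Q' ⟶ Q} (hl₁ : l ≫ fst = fst' ≫ g)
      (hl₂ : l ≫ snd = snd') (hl₃ : l ≫ ev = ev') : f ≫ g = 𝟙 P ∧ k ≫ l = 𝟙 Q := by
    have hkl : (k ≫ l) ≫ fst = fst ≫ f ≫ g := by
      rw [Category.assoc, hl₁, ← Category.assoc, hk₁, Category.assoc]
    have hkl' : (k ≫ l) ≫ snd = snd := by rw [Category.assoc, hl₂, hk₂]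
    have hfg : f ≫ g = 𝟙 P := by
      refine (h.2 fst snd h.1 ev).unique ⟨k ≫ l, hkl, hkl', ?_⟩ ⟨𝟙 Q, ?_, ?_, ?_⟩
      · rw [Category.assoc, hl₃, hk₃]
      all_goals simp
    refine ⟨hfg, (nonempty_isLimit_binaryFan_iff.1 h.1 fst snd).unique ⟨?_, hkl'⟩ (by simp)⟩
    rw [hkl, hfg, Category.comp_id]
  obtain ⟨f, ⟨k, hk₁, hk₂, hk₃⟩, -⟩ := h'.2 fst snd h.1 ev
  obtain ⟨g, ⟨l, hl₁, hl₂, hl₃⟩, -⟩ := h.2 fst' snd' h'.1 ev'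
  have h₁ := aux h hk₁ hk₂ hk₃ hl₁ hl₂ hl₃
  have h₂ := aux h' hl₁ hl₂ hl₃ hk₁ hk₂ hk₃
  exact ⟨⟨f, g, h₁.1, h₂.1⟩, ⟨k, l, h₁.2, h₂.2⟩, hk₁, hk₂, hk₃⟩

/-- The structure underlying `IsSubobjectClassifier`. -/
noncomputable def IsSubobjectClassifier.classifier {Ω₀ Ω : C} {t : Ω₀ ⟶ Ω}
    (ht : IsSubobjectClassifier t) : Subobject.Classifier C :=
  .mkOfTerminalΩ₀ Ω₀ ht.1.some Ω t (fun m _ ↦ (ht.2 m).choose)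
    (fun m _ ↦ by
      obtain ⟨χ₀, h⟩ := (ht.2 m).choose_spec.1
      rwa [ht.1.some.hom_ext (ht.1.some.from _) χ₀])
    (fun m _ χ' h ↦ (ht.2 m).choose_spec.2 χ' ⟨_, h⟩)

lemma IsSubobjectClassifier.of_iso {Ω₀ Ω Ω₀' Ω' : C} {t : Ω₀ ⟶ Ω} {t' : Ω₀' ⟶ Ω'}
    (h : IsSubobjectClassifier t') (e₀ : Ω₀ ≅ Ω₀') (e : Ω ≅ Ω') (w : t ≫ e.hom = e₀.hom ≫ t') :
    IsSubobjectClassifier t := by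
  obtain ⟨⟨h₀⟩, h⟩ := h
  have w' : e₀.inv ≫ t = t' ≫ e.inv := by
    rw [Iso.inv_comp_eq, ← Category.assoc, Iso.eq_comp_inv, w]
  refine ⟨⟨h₀.ofIso e₀.symm⟩, fun U X m _ ↦ ?_⟩
  obtain ⟨χ, ⟨χ₀, hχ⟩, uniq⟩ := h m
  refine ⟨χ ≫ e.inv, ⟨χ₀ ≫ e₀.inv, ?_⟩, ?_⟩
  · exact hχ.of_iso (Iso.refl _) (Iso.refl _) e₀.symm e.symm (by simp) (by simp) (by simp)
      w'.symm
  · rintro χ' ⟨χ₀', hχ'⟩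
    rw [Iso.eq_comp_inv]
    exact uniq _ ⟨χ₀' ≫ e₀.hom, hχ'.of_iso (Iso.refl _) (Iso.refl _) e₀ e (by simp) (by simp)
      (by simp) w⟩

lemma IsSubobjectClassifier.exists_iso {Ω₀ Ω Ω₀' Ω' : C} {t : Ω₀ ⟶ Ω} {t' : Ω₀' ⟶ Ω'}
    (h : IsSubobjectClassifier t) (h' : IsSubobjectClassifier t') :
    ∃ (e₀ : Ω₀ ≅ Ω₀') (e : Ω ≅ Ω'), t ≫ e.hom = e₀.hom ≫ t' := by
  refine ⟨h.1.some.uniqueUpToIso h'.1.some, h.classifier.uniqueUpToIso h'.classifier, ?_⟩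
  refine (Subobject.Classifier.truth_comp_hom (𝒞₁ := h.classifier) (𝒞₂ := h'.classifier)).trans ?_
  exact congrArg (· ≫ t') (h'.1.some.hom_ext _ _)

end Uniqueness

/-! ### Logical subtoposes and their replete closure -/

section FullSubcategory

variable {C : Type u} [Category.{v} C]

lemma IsLogicalSubtopos.isClosedUnderLimitsOfShape {E : ObjectProperty C} (hE : IsLogicalSubtopos E)
    [E.IsClosedUnderIsomorphisms] (J : Type) [SmallCategory J] [FinCategory J] :
    E.IsClosedUnderLimitsOfShape J where
  limitsOfShape_le := by
    rintro X ⟨h⟩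
    obtain ⟨c, ⟨hc⟩, hcE⟩ := hE.exists_limit J h.diag h.prop_diag_obj
    exact E.prop_of_iso (hc.conePointUniqueUpToIso h.isLimit) hcE

lemma IsTopos.isLogicalSubtopos_top [IsTopos C] : IsLogicalSubtopos (⊤ : ObjectProperty C) where
  exists_limit J _ _ K _ := ⟨limit.cone K, ⟨limit.isLimit K⟩, trivial⟩
  exists_exponential {A B} _ _ := by
    obtain ⟨P, Q, fst, snd, ev, h⟩ := IsTopos.exists_exponential A B
    exact ⟨P, Q, fst, snd, ev, h, trivial⟩
  exists_classifier := ⟨HasSubobjectClassifier.exists_classifier.some, trivial⟩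

lemma IsLogicalSubtopos.isTopos {E : ObjectProperty C} (hE : IsLogicalSubtopos E)
    (h : ∀ X, E X) : IsTopos C where
  out J _ _ := ⟨fun K ↦ by
    obtain ⟨c, ⟨hc⟩, -⟩ := hE.exists_limit J K fun _ ↦ h _
    exact ⟨⟨c, hc⟩⟩⟩
  exists_classifier := ⟨hE.exists_classifier.choose⟩
  exists_exponential A B := by
    obtain ⟨P, Q, fst, snd, ev, h, -⟩ := hE.exists_exponential (h A) (h B)
    exact ⟨P, Q, fst, snd, ev, h⟩

lemma HasExponentialIn.of_iso [HasBinaryProducts C] {S : ObjectProperty C} {A B A' B' : C}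
    (eA : A ≅ A') (eB : B ≅ B') (h : HasExponentialIn S A B) : HasExponentialIn S A' B' := by
  refine RepresentableIn.of_equiv
    (fun T ↦ (prod.mapIso eA (Iso.refl T)).homCongr eB) (fun f x ↦ ?_) h
  simp

/-- Repleteness turns closure under some choice of limits into closure under all of them, so the
closure under isomorphism is what gets sliced later. -/
lemma IsLogicalSubtopos.isoClosure [IsTopos C] {E : ObjectProperty C} (hE : IsLogicalSubtopos E) :
    IsLogicalSubtopos E.isoClosure where
  exists_limit J _ _ K hK := by
    choose K' hK' e using hK
    obtain ⟨c, ⟨hc⟩, hcE⟩ := hE.exists_limit J (K.copyObj K' fun j ↦ (e j).some) hK'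
    exact ⟨_, ⟨(IsLimit.postcomposeInvEquiv (K.isoCopyObj K' fun j ↦ (e j).some) c).symm hc⟩,
      E.le_isoClosure _ hcE⟩
  exists_exponential {A B} := by
    rintro ⟨A', hA, ⟨eA⟩⟩ ⟨B', hB, ⟨eB⟩⟩
    obtain ⟨P, Q, fst, snd, ev, h, hP⟩ := hE.exists_exponential hA hB
    exact HasExponentialIn.exists_isExponential (.of_iso eA.symm eB.symm
      ⟨P, E.le_isoClosure _ hP, h.nonempty_representation⟩)
  exists_classifier := by
    obtain ⟨c, hc⟩ := hE.exists_classifier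
    exact ⟨c, E.le_isoClosure _ hc⟩

end FullSubcategory

/-! ### The fundamental theorem for slices -/

section Slice

variable {F : Type u} [Category.{v} F]

/-- A limit in the slice is a limit in `F` of the diagram extended by `A` as a terminal vertex;
hence the need for `S A`. -/
lemma isClosedUnderLimitsOfShape_inverseImage_forget {S : ObjectProperty F} {A : F} (hA : S A)
    (J : Type w₁) [Category.{w₂} J] [S.IsClosedUnderLimitsOfShape (WithTerminal J)] :
    (S.inverseImage (Over.forget A)).IsClosedUnderLimitsOfShape J where
  limitsOfShape_le := by
    rintro X ⟨h⟩
    refine S.prop_of_isLimit (WithTerminal.isLimitEquiv.symm h.isLimit) ?_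
    rintro (j | _)
    · exact h.prop_diag_obj j
    · exact hA

variable [IsTopos F]

/-- The fundamental theorem of topos theory, relative to a logical subtopos. -/
theorem IsLogicalSubtopos.inverseImage_forget {S : ObjectProperty F} (hS : IsLogicalSubtopos S)
    [S.IsClosedUnderIsomorphisms] {A : F} (hA : S A) :
    IsLogicalSubtopos (S.inverseImage (Over.forget A)) := by
  have hJ (J : Type) [SmallCategory J] [FinCategory J] :
      (S.inverseImage (Over.forget A)).IsClosedUnderLimitsOfShape J :=
    have := hS.isClosedUnderLimitsOfShape (WithTerminal J)
    isClosedUnderLimitsOfShape_inverseImage_forget hA J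
  have := hS.isClosedUnderLimitsOfShape (Discrete WalkingPair)
  have := hJ (Discrete WalkingPair)
  have := hJ WalkingParallelPair
  -- The domain of `(Over.star A).obj Y` is the product of `A` and `Y`.
  have hstar (Y : F) (hY : S Y) : S.inverseImage (Over.forget A) ((Over.star A).obj Y) :=
    S.prop_limit (pair A Y) (by rintro ⟨_ | _⟩ <;> assumption)
  obtain ⟨c, hc⟩ := hS.exists_classifier
  let c' := ((isSubobjectClassifier_truth c).map_of_isSliceProjection (Over.forgetAdjStar A)
    (isSliceProjection_forget A)).classifier
  refine ⟨fun J _ _ K hK ↦ ⟨limit.cone K, ⟨limit.isLimit K⟩, ?_⟩, fun {X Y} hX hY ↦ ?_,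
    ⟨c', hstar _ hc⟩⟩
  · have := hJ J
    exact ObjectProperty.prop_limit _ _ hK
  · refine (HasExponentialIn.of_power c' (fun Z hZ ↦ ?_) hX hY).exists_isExponential
    refine .of_isSliceProjection (Over.forgetAdjStar A) (isSliceProjection_forget A) c hstar ?_
    obtain ⟨P, Q, fst, snd, ev, h, hP⟩ := hS.exists_exponential hZ hc
    exact ⟨P, hP, h.nonempty_representation⟩

instance (A : F) : IsTopos (Over A) :=
  (IsTopos.isLogicalSubtopos_top.inverseImage_forget (A := A) trivial).isTopos fun _ ↦ trivial

theorem isLogicalFunctor_pullback {A B : F} (f : A ⟶ B) : IsLogicalFunctor (Over.pullback f) :=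
  isLogicalFunctor_of_isSliceProjection (Over.mapPullbackAdj f) (isSliceProjection_map f)

end Slice

/-! ### Fully faithful functors reflect topos structure -/

section Reflect

variable {C : Type u} [Category.{v} C] {D : Type u'} [Category.{v'} D] (G : C ⥤ D)
  [G.Full] [G.Faithful]

lemma IsExponential.of_map [PreservesLimitsOfShape (Discrete WalkingPair) G] {A B P Q : C}
    {fst : Q ⟶ P} {snd : Q ⟶ A} {ev : Q ⟶ B}
    (h : IsExponential (G.map fst) (G.map snd) (G.map ev)) : IsExponential fst snd ev := by
  refine ⟨h.1.map (isLimitOfReflectsOfMapIsLimit G _ _), fun X Y p q hpq g ↦ ?_⟩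
  obtain ⟨f, ⟨k, hk₁, hk₂, hk₃⟩, hf⟩ :=
    h.2 _ _ (hpq.map (mapIsLimitOfPreservesOfIsLimit G _ _)) (G.map g)
  refine ⟨G.preimage f, ⟨G.preimage k, ?_, ?_, ?_⟩, ?_⟩
  · exact G.map_injective (by simpa using hk₁)
  · exact G.map_injective (by simpa using hk₂)
  · exact G.map_injective (by simpa using hk₃)
  · rintro f' ⟨k', hk₁', hk₂', hk₃'⟩
    refine G.map_injective ((hf _ ⟨G.map k', ?_, ?_, ?_⟩).trans (G.map_preimage f).symm)
    · rw [← G.map_comp, hk₁', G.map_comp]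
    · rw [← G.map_comp, hk₂']
    · rw [← G.map_comp, hk₃']

lemma IsSubobjectClassifier.of_map [PreservesLimitsOfShape WalkingCospan G] {Ω₀ Ω : C} {t : Ω₀ ⟶ Ω}
    (h : IsSubobjectClassifier (G.map t)) : IsSubobjectClassifier t := by
  obtain ⟨⟨h₀⟩, h⟩ := h
  refine ⟨⟨h₀.isTerminalOfObj G _⟩, fun U X m _ ↦ ?_⟩
  obtain ⟨χ, ⟨χ₀, hχ⟩, uniq⟩ := h (G.map m)
  refine ⟨G.preimage χ, ⟨G.preimage χ₀, ?_⟩, ?_⟩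
  · apply IsPullback.of_map_of_faithful G
    simpa using hχ
  · rintro χ' ⟨χ₀', hχ'⟩
    apply G.map_injective
    rw [G.map_preimage]
    exact uniq _ ⟨_, hχ'.map G⟩

end Reflect

/-! ### A replete logical subtopos is a topos with logical inclusion -/

section FullSubcategory

variable {C : Type u} [Category.{v} C] [IsTopos C] {S : ObjectProperty C}
  (hS : IsLogicalSubtopos S) [S.IsClosedUnderIsomorphisms]

include hS

lemma IsLogicalSubtopos.preservesFiniteLimits_ι : PreservesFiniteLimits S.ι where
  preservesFiniteLimits J _ _ := by
    have := hS.isClosedUnderLimitsOfShape J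
    infer_instance

omit [IsTopos C] in
lemma IsLogicalSubtopos.exists_exponential_fullSubcategory (A B : S.FullSubcategory) :
    ∃ (P Q : S.FullSubcategory) (fst : Q ⟶ P) (snd : Q ⟶ A) (ev : Q ⟶ B),
      IsExponential (S.ι.map fst) (S.ι.map snd) (S.ι.map ev) := by
  obtain ⟨P, Q, fst, snd, ev, h, hP⟩ := hS.exists_exponential A.property B.property
  have := hS.isClosedUnderLimitsOfShape (Discrete WalkingPair)
  have hQ : S Q := S.prop_of_isLimit h.1.some (by
    rintro ⟨_ | _⟩
    · exact hP
    · exact A.property)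
  exact ⟨⟨P, hP⟩, ⟨Q, hQ⟩, ObjectProperty.homMk fst, ObjectProperty.homMk snd,
    ObjectProperty.homMk ev, h⟩

omit [IsTopos C] in
lemma IsLogicalSubtopos.exists_classifier_fullSubcategory :
    ∃ (Ω₀ Ω : S.FullSubcategory) (t : Ω₀ ⟶ Ω), IsSubobjectClassifier (S.ι.map t) := by
  obtain ⟨c, hc⟩ := hS.exists_classifier
  have := hS.isClosedUnderLimitsOfShape (Discrete PEmpty)
  have h₀ : S c.Ω₀ := S.prop_of_isTerminal _ c.isTerminalΩ₀
  exact ⟨⟨_, h₀⟩, ⟨_, hc⟩, ObjectProperty.homMk c.truth, isSubobjectClassifier_truth c⟩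

lemma IsLogicalSubtopos.isTopos_fullSubcategory : IsTopos S.FullSubcategory where
  out J _ _ := by
    have := hS.isClosedUnderLimitsOfShape J
    infer_instance
  exists_classifier := by
    have := hS.preservesFiniteLimits_ι
    obtain ⟨Ω₀, Ω, t, h⟩ := hS.exists_classifier_fullSubcategory
    exact ⟨(h.of_map S.ι).classifier⟩
  exists_exponential A B := by
    have := hS.preservesFiniteLimits_ι
    obtain ⟨P, Q, fst, snd, ev, h⟩ := hS.exists_exponential_fullSubcategory A B
    exact ⟨P, Q, fst, snd, ev, h.of_map S.ι⟩

/-- Structure internal to the subcategory is isomorphic to the structure of `C` chosen inside `S`,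
which the inclusion preserves by construction. -/
theorem IsLogicalSubtopos.isLogicalFunctor_ι : IsLogicalFunctor S.ι where
  preservesFiniteLimits := hS.preservesFiniteLimits_ι
  map_exponential {A B P Q} fst snd ev h := by
    have := hS.preservesFiniteLimits_ι
    obtain ⟨P', Q', fst', snd', ev', h'⟩ := hS.exists_exponential_fullSubcategory A B
    obtain ⟨eP, eQ, h₁, h₂, h₃⟩ := h.exists_iso (h'.of_map S.ι)
    exact h'.of_iso (S.ι.mapIso eP) (S.ι.mapIso eQ)
      (by rw [Functor.mapIso_hom, Functor.mapIso_hom, ← S.ι.map_comp, h₁, S.ι.map_comp])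
      (by rw [Functor.mapIso_hom, ← S.ι.map_comp, h₂])
      (by rw [Functor.mapIso_hom, ← S.ι.map_comp, h₃])
  map_classifier c := by
    have := hS.preservesFiniteLimits_ι
    obtain ⟨Ω₀, Ω, t, h⟩ := hS.exists_classifier_fullSubcategory
    obtain ⟨e₀, e, w⟩ := (isSubobjectClassifier_truth c).exists_iso (h.of_map S.ι)
    exact h.of_iso (S.ι.mapIso e₀) (S.ι.mapIso e)
      (by rw [Functor.mapIso_hom, Functor.mapIso_hom, ← S.ι.map_comp, w, S.ι.map_comp])

variable {D : Type u'} [Category.{v'} D] [IsTopos D] {S' : ObjectProperty D}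
  (hS' : IsLogicalSubtopos S') [S'.IsClosedUnderIsomorphisms]

include hS'

/-- A logical functor restricts to a logical functor between logical subtoposes. -/
theorem IsLogicalFunctor.lift {G : C ⥤ D} (hG : IsLogicalFunctor G) (h : ∀ X, S X → S' (G.obj X)) :
    IsLogicalFunctor (S'.lift (S.ι ⋙ G) fun X ↦ h _ X.property) := by
  have := hS'.preservesFiniteLimits_ι
  have := hS.preservesFiniteLimits_ι
  have := hG.preservesFiniteLimits
  refine ⟨?_, fun fst snd ev he ↦ ?_, fun c ↦ ?_⟩
  · have : PreservesFiniteLimits (S'.lift (S.ι ⋙ G) (fun X ↦ h _ X.property) ⋙ S'.ι) :=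
      inferInstanceAs (PreservesFiniteLimits (S.ι ⋙ G))
    exact preservesFiniteLimits_of_reflects_of_preserves _ S'.ι
  · exact IsExponential.of_map S'.ι
      (hG.map_exponential _ _ _ (hS.isLogicalFunctor_ι.map_exponential _ _ _ he) :)
  · exact IsSubobjectClassifier.of_map S'.ι
      (hG.map_classifier (hS.isLogicalFunctor_ι.map_classifier c).classifier)

end FullSubcategory

/-! ### Locally small maps -/

section LocallySmall

variable {F : Type u} [Category.{v} F]

/-- Phrases local smallness as a condition on the functors `Over.pullback f`, so that their
logicality can be applied. -/
lemma isLocallySmallMap_iff [HasPullbacks F] {E : ObjectProperty F} {X B : F} {p : X ⟶ B} :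
    IsLocallySmallMap E p ↔
      ∀ ⦃A : F⦄, E A → ∀ f : A ⟶ B, E.isoClosure (pullback p f) := by
  refine ⟨fun h A hA f ↦ ?_, fun h A hA f ↦ ?_⟩
  · obtain ⟨Y, fst, snd, hY, hp⟩ := h hA f
    exact ⟨Y, hY, ⟨hp.isoPullback.symm⟩⟩
  · obtain ⟨Y, hY, ⟨e⟩⟩ := h hA f
    exact ⟨Y, e.inv ≫ pullback.fst p f, e.inv ≫ pullback.snd p f, hY,
      (IsPullback.of_hasPullback p f).of_iso e (Iso.refl _) (Iso.refl _) (Iso.refl _)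
        (by simp) (by simp) (by simp) (by simp)⟩

instance (E : ObjectProperty F) (I : F) :
    ObjectProperty.IsClosedUnderIsomorphisms (fun p : Over I ↦ IsLocallySmallMap E p.hom) where
  of_iso {p q} e h A hA f := by
    obtain ⟨Y, fst, snd, hY, hp⟩ := h hA f
    exact ⟨Y, fst ≫ e.hom.left, snd, hY, hp.of_iso (Iso.refl _) ((Over.forget I).mapIso e)
      (Iso.refl _) (Iso.refl _) (by simp) (by simp) (by simp) (by simp)⟩

/-- The locally `E`-small maps with codomain `I` form a logical subtopos of the slice. -/
theorem IsLogicalSubtopos.locallySmallMap [IsTopos F] {E : ObjectProperty F}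
    (hE : IsLogicalSubtopos E) (I : F) :
    IsLogicalSubtopos (fun p : Over I ↦ IsLocallySmallMap E p.hom) := by
  have hA {A : F} (hA : E A) := hE.isoClosure.inverseImage_forget (E.le_isoClosure _ hA)
  refine ⟨fun J _ _ K hK ↦ ⟨limit.cone K, ⟨limit.isLimit K⟩, ?_⟩, fun {X Y} hX hY ↦ ?_, ?_⟩
  · refine isLocallySmallMap_iff.2 fun A h f ↦ ?_
    have := (hA h).isClosedUnderLimitsOfShape J
    exact (E.isoClosure.inverseImage (Over.forget A)).prop_of_isLimit
      (isLimitOfPreserves (Over.pullback f) (limit.isLimit K))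
      fun j ↦ isLocallySmallMap_iff.1 (hK j) h f
  -- The exponential is taken in the whole slice over `I`. Its pullback to `A` is again an
  -- exponential, hence isomorphic to the one with small domain.
  · obtain ⟨P, Q, fst, snd, ev, he⟩ := IsTopos.exists_exponential X Y
    refine ⟨P, Q, fst, snd, ev, he, isLocallySmallMap_iff.2 fun A h f ↦ ?_⟩
    obtain ⟨P', Q', fst', snd', ev', he', hP'⟩ := (hA h).exists_exponential
      (A := (Over.pullback f).obj X) (B := (Over.pullback f).obj Y)
      (isLocallySmallMap_iff.1 hX h f) (isLocallySmallMap_iff.1 hY h f)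
    obtain ⟨e, -⟩ := he'.exists_iso ((isLogicalFunctor_pullback f).map_exponential _ _ _ he)
    exact E.isoClosure.prop_of_iso ((Over.forget A).mapIso e) hP'
  · obtain ⟨c⟩ := HasSubobjectClassifier.exists_classifier (C := Over I)
    refine ⟨c, isLocallySmallMap_iff.2 fun A h f ↦ ?_⟩
    obtain ⟨c', hc'⟩ := (hA h).exists_classifier
    obtain ⟨-, e, -⟩ := (isSubobjectClassifier_truth c').exists_iso
      ((isLogicalFunctor_pullback f).map_classifier c)
    exact E.isoClosure.prop_of_iso ((Over.forget A).mapIso e) hc'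

end LocallySmall

end DenseTopos

/-! ### The indexed statement, assembled fibre by fibre -/

theorem mainTheorem5 {F : Type u} [Category.{v} F] [DenseTopos.IsTopos F] (E : ObjectProperty F)
    (hE : DenseTopos.IsDenseLogicalSubtopos E) : DenseTopos.IsIndexedLogicalSubtopos (DenseTopos.locallySmallMaps E) := by
  have h (I : F) := hE.isLogicalSubtopos.locallySmallMap I
  exact {
    ambient := {
      isTopos := fun I ↦ inferInstanceAs (DenseTopos.IsTopos (Over I.as.unop))
      isLogical := fun f ↦ DenseTopos.isLogicalFunctor_pullback f.as.unop }
    sub := {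
      isTopos := fun I ↦ (h I.as.unop).isTopos_fullSubcategory
      isLogical := fun {I J} f ↦ DenseTopos.IsLogicalFunctor.lift (h I.as.unop) (h J.as.unop)
        (DenseTopos.isLogicalFunctor_pullback f.as.unop)
        (fun p hp ↦ DenseTopos.IsLocallySmallMap.pullback hp f.as.unop) }
    fiber := fun I ↦ h I.as.unop }
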